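/- All graphs are finite and simple. A \emph{marked permutation graph} is a pair $(G,M)$, where $G$ is a cubic graph and $M$ is a perfect matching of $G$ such that $G-E(M)$ is the disjoint union of two cycles, neither of which has a chord in $G$. An \emph{$M$-copy of $C_4$} is a $4$-cycle in $G$ that uses exactly two edges of $M$. An \emph{$M$-copy of the Petersen graph $P_{10}$} is a subgraph of $G$ that is isomorphic to a subdivision of $P_{10}$ and is composed of the two cycles of $G-E(M)$ together with exactly five edges of $M$. \textbf{Theorem.} Let $(G,M)$ be a marked permutation graph on at least six vertices and let $e\in E(M)$. If $e$ is contained in every $M$-copy of $C_4$ in $G$, then $e$ is contained in an $M$-copy of $P_{10}$. -/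

import Mathlib

namespace PermutationGraph

variable {V W : Type*}

/-- The Petersen graph, on two copies of `ZMod 5`: an outer pentagon `i ~ i + 1`, an inner
pentagram `i ~ i + 2`, and the five spokes joining the two copies of each `i`. -/
def petersenGraph : SimpleGraph (ZMod 5 ⊕ ZMod 5) where
  Adj
    | Sum.inl i, Sum.inl j => j = i + 1 ∨ i = j + 1
    | Sum.inr i, Sum.inr j => j = i + 2 ∨ i = j + 2
    | Sum.inl i, Sum.inr j => i = j
    | Sum.inr i, Sum.inl j => i = j
  symm := ⟨by
    rintro (i | i) (j | j) h
    · exact h.symm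
    · exact h.symm
    · exact h.symm
    · exact h.symm⟩
  loopless := ⟨by
    rintro (i | i) h
    · revert h; revert i; decide
    · revert h; revert i; decide⟩

/-- `H` is isomorphic to a subdivision of `K`: there are distinct branch vertices `b x` of `H`,
one for each vertex `x` of `K`, and for each edge `xy` of `K` a path of `H` between `b x` and
`b y` (the same path, reversed, for `yx`), such that an inner vertex of one of these paths is
neither a branch vertex nor on any other of these paths, and every vertex and every edge of `H`
is used. -/
def IsSubdivisionOf (H : SimpleGraph V) (K : SimpleGraph W) : Prop :=
  ∃ (b : W ↪ V) (p : ∀ x y : W, K.Adj x y → H.Walk (b x) (b y)),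
    (∀ x y (h : K.Adj x y), (p x y h).IsPath) ∧
    (∀ x y (h : K.Adj x y), p y x h.symm = (p x y h).reverse) ∧
    (∀ x y (h : K.Adj x y), ∀ v ∈ (p x y h).support, v ≠ b x → v ≠ b y →
      v ∉ Set.range b ∧
      ∀ x' y' (h' : K.Adj x' y'), v ∈ (p x' y' h').support → s(x, y) = s(x', y')) ∧
    (∀ v : V, v ∈ Set.range b ∨ ∃ x y, ∃ h : K.Adj x y, v ∈ (p x y h).support) ∧
    (∀ f ∈ H.edgeSet, ∃ x y, ∃ h : K.Adj x y, f ∈ (p x y h).edges)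

/-- `(G, M)` is a marked permutation graph: `G` is cubic, `M` is a perfect matching of `G`,
`G - E(M)` is the disjoint union of two cycles, and neither cycle has a chord in `G`, i.e. every
edge of `G` between two vertices of the same cycle is an edge of that cycle. -/
structure IsMarked [Fintype V] (G : SimpleGraph V) [DecidableRel G.Adj] (M : G.Subgraph) :
    Prop where
  cubic : G.IsRegularOfDegree 3
  perfect : M.IsPerfectMatching
  cycles : ∃ (m n : ℕ), 3 ≤ m ∧ 3 ≤ n ∧
    ∃ φ : SimpleGraph.cycleGraph m ⊕g SimpleGraph.cycleGraph n ≃g G.deleteEdges M.edgeSet,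
      (∀ i j : Fin m, G.Adj (φ (Sum.inl i)) (φ (Sum.inl j)) →
        (SimpleGraph.cycleGraph m).Adj i j) ∧
      (∀ i j : Fin n, G.Adj (φ (Sum.inr i)) (φ (Sum.inr j)) →
        (SimpleGraph.cycleGraph n).Adj i j)

/-- The closed walk `w` runs once around an `M`-copy of `C₄`: a 4-cycle of `G` that uses
exactly two edges of `M`. -/
def IsMC4 {G : SimpleGraph V} (M : G.Subgraph) {v : V} (w : G.Walk v v) : Prop :=
  w.IsCycle ∧ w.length = 4 ∧ {f | f ∈ w.edges ∧ f ∈ M.edgeSet}.ncard = 2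

/-- `H` is an `M`-copy of the Petersen graph in `G`: it is composed of `G - E(M)` (for a marked
permutation graph, the two cycles, which cover all vertices) together with exactly five edges of
`M`, and is isomorphic to a subdivision of the Petersen graph. -/
def IsMP10 {G : SimpleGraph V} (M : G.Subgraph) (H : SimpleGraph V) : Prop :=
  (∃ F : Set (Sym2 V), F ⊆ M.edgeSet ∧ F.ncard = 5 ∧
    H = G.deleteEdges M.edgeSet ⊔ SimpleGraph.fromEdgeSet F) ∧
  IsSubdivisionOf H petersenGraph

end PermutationGraph

/-! Number both cycles from the ends of `e`, so that `M` becomes a bijection `f` between positions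
with `f 0 = 0`, and look at `f` on the positions `1, …, m - 1`. If `f` contains `3142`, these four
edges and `e` join the two cycles in exactly the cyclic order of the Petersen spokes
(`IsTwoCycleParam.exists_isMP10`); reversing the second cycle turns `2413` into `3142`.

Otherwise `f` is a separable permutation there: every set of at least two positions splits into an
initial and a final part with all values of one part below those of the other
(`AvoidsPatterns.sumDecomposes`). Splitting repeatedly ends in two positions that are consecutive
and have consecutive values (`AvoidsPatterns.exists_twins`). The two `M`-edges there lie in an
`M`-copy of `C₄` that misses `e`, contrary to the hypothesis. -/

namespace PermutationGraph

/-! ### Separable permutations: sum and skew decompositions -/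

/-- `f` contains neither of the patterns `3142` and `2413` on `S`. -/
def AvoidsPatterns (f : ℕ → ℤ) (S : Finset ℕ) : Prop :=
  ∀ w ∈ S, ∀ x ∈ S, ∀ y ∈ S, ∀ z ∈ S, w < x → x < y → y < z →
    ¬ (f x < f z ∧ f z < f w ∧ f w < f y) ∧ ¬ (f y < f w ∧ f w < f z ∧ f z < f x)

/-- `S` splits into an initial and a final part, with `f` smaller on the initial part. -/
def SumDecomposes (f : ℕ → ℤ) (S : Finset ℕ) : Prop :=
  ∃ A B : Finset ℕ, A.Nonempty ∧ B.Nonempty ∧ A ∪ B = S ∧ ∀ a ∈ A, ∀ b ∈ B, a < b ∧ f a < f b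

theorem AvoidsPatterns.mono {f : ℕ → ℤ} {S T : Finset ℕ} (h : AvoidsPatterns f S) (hT : T ⊆ S) :
    AvoidsPatterns f T :=
  fun w hw x hx y hy z hz => h w (hT hw) x (hT hx) y (hT hy) z (hT hz)

/-- Negating the values exchanges `3142` and `2413`. Values are integers so that a skew
decomposition of `f` is a sum decomposition of `-f`. -/
theorem AvoidsPatterns.neg {f : ℕ → ℤ} {S : Finset ℕ} (h : AvoidsPatterns f S) :
    AvoidsPatterns (-f) S := by
  intro w hw x hx y hy z hz h1 h2 h3
  have := h w hw x hx y hy z hz h1 h2 h3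
  simp only [Pi.neg_apply, neg_lt_neg_iff]
  tauto

/-- Take `A` as small as possible. If `x` fits neither above `A` nor below everything, then `A` has
values on both sides of `f x`. By minimality `A` has no sum decomposition, so it has a skew one, and
an element of each of its parts, one of `B` and `x` form `3142`. -/
theorem SumDecomposes.insert_max {f : ℕ → ℤ} {S : Finset ℕ} {x : ℕ} (hS : SumDecomposes f S)
    (hx : ∀ s ∈ S, s < x) (hfx : ∀ s ∈ S, f s ≠ f x)
    (ih : ∀ T ⊆ S, 2 ≤ T.card → SumDecomposes f T ∨ SumDecomposes (-f) T)
    (hav : AvoidsPatterns f (insert x S)) :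
    SumDecomposes f (insert x S) ∨ SumDecomposes (-f) (insert x S) := by
  classical
  have hex : ∃ k, ∃ A B : Finset ℕ, A.card = k ∧ A.Nonempty ∧ B.Nonempty ∧ A ∪ B = S ∧
      ∀ a ∈ A, ∀ b ∈ B, a < b ∧ f a < f b := by
    obtain ⟨A, B, h⟩ := hS
    exact ⟨_, A, B, rfl, h⟩
  obtain ⟨A, B, hcard, hA, hB, hAB, hlt⟩ := Nat.find_spec hex
  have hmin := fun k hk => Nat.find_min hex (m := k) hk
  rw [← hcard] at hmin
  subst hAB
  by_cases h1 : ∀ a ∈ A, f a < f x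
  · refine Or.inl ⟨A, insert x B, hA, by simp, by ext; simp, fun a ha b hb => ?_⟩
    rcases Finset.mem_insert.1 hb with rfl | hb
    · exact ⟨hx a (by simp [ha]), h1 a ha⟩
    · exact hlt a ha b hb
  by_cases h2 : ∀ s ∈ A ∪ B, f x < f s
  · refine Or.inr ⟨A ∪ B, {x}, by simp [hA], by simp, by ext; simp, fun a ha b hb => ?_⟩
    rw [Finset.mem_singleton.1 hb]
    exact ⟨hx a ha, by simpa using h2 a ha⟩
  push Not at h1 h2
  obtain ⟨a, ha, hxa⟩ := h1
  obtain ⟨s, hs, hsx⟩ := h2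
  have hxa := lt_of_le_of_ne hxa (hfx a (by simp [ha])).symm
  have hsx := lt_of_le_of_ne hsx (hfx s hs)
  have hsA : s ∈ A := by
    rcases Finset.mem_union.1 hs with h | h
    · exact h
    · have := (hlt a ha s h).2
      omega
  have hA2 : 2 ≤ A.card := by
    apply Finset.one_lt_card.2 ⟨a, ha, s, hsA, _⟩
    rintro rfl
    omega
  exfalso
  rcases ih A Finset.subset_union_left hA2 with ⟨C, D, hC, hD, rfl, hCD⟩ | ⟨C, D, hC, hD, rfl, hCD⟩
  -- A sum decomposition of `A` would give the split `C`, `D ∪ B` with a smaller first part.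
  · refine hmin C.card ?_ ⟨C, D ∪ B, rfl, hC, by simp [hD], by rw [Finset.union_assoc], ?_⟩
    · obtain ⟨d, hd⟩ := hD
      apply Finset.card_lt_card
      refine ⟨Finset.subset_union_left, fun h => ?_⟩
      exact absurd (hCD d (h (by simp [hd])) d hd).1 (lt_irrefl _)
    · intro c hc b hb
      rcases Finset.mem_union.1 hb with hb | hb
      · exact hCD c hc b hb
      · exact hlt c (by simp [hc]) b hb
  · simp only [Pi.neg_apply, neg_lt_neg_iff] at hCD
    obtain ⟨b, hb⟩ := hB
    obtain ⟨c, hc, hxc⟩ : ∃ c ∈ C, f x < f c := by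
      rcases Finset.mem_union.1 ha with h | h
      · exact ⟨a, h, hxa⟩
      · obtain ⟨c, hc⟩ := hC
        exact ⟨c, hc, hxa.trans (hCD c hc a h).2⟩
    obtain ⟨d, hd, hdx⟩ : ∃ d ∈ D, f d < f x := by
      rcases Finset.mem_union.1 hsA with h | h
      · obtain ⟨d, hd⟩ := hD
        exact ⟨d, hd, (hCD s h d hd).2.trans hsx⟩
      · exact ⟨s, h, hsx⟩
    -- At the positions `c < d < b < x` the values have the pattern `3142`.
    exact (hav c (by simp [hc]) d (by simp [hd]) b (by simp [hb]) x (by simp) (hCD c hc d hd).1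
      (hlt d (by simp [hd]) b hb).1 (hx b (by simp [hb]))).1
      ⟨hdx, hxc, (hlt c (by simp [hc]) b hb).2⟩

theorem AvoidsPatterns.sumDecomposes {f : ℕ → ℤ} {S : Finset ℕ} (hav : AvoidsPatterns f S)
    (hf : Set.InjOn f S) (hS : 2 ≤ S.card) : SumDecomposes f S ∨ SumDecomposes (-f) S := by
  classical
  induction S using Finset.strongInduction with
  | H S ih =>
    have hne : S.Nonempty := Finset.card_pos.1 (by omega)
    obtain ⟨x, T, hxT, hTx, rfl⟩ : ∃ x T, x ∉ T ∧ (∀ t ∈ T, t < x) ∧ S = insert x T := by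
      refine ⟨S.max' hne, S.erase (S.max' hne), by simp, fun t ht => ?_, ?_⟩
      · exact lt_of_le_of_ne (S.le_max' t (Finset.mem_of_mem_erase ht)) (Finset.ne_of_mem_erase ht)
      · rw [Finset.insert_erase (S.max'_mem hne)]
    have hfx : ∀ s ∈ T, f s ≠ f x := fun s hs h => by
      have := hf (by simp [hs]) (by simp) h
      exact hxT (this ▸ hs)
    have ihT : ∀ R ⊆ T, 2 ≤ R.card → SumDecomposes f R ∨ SumDecomposes (-f) R := fun R hR h2 => by
      have hss : R ⊆ insert x T := hR.trans (Finset.subset_insert _ _)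
      refine ih R ⟨hss, fun h => hxT (hR (h (by simp)))⟩ (hav.mono hss)
        (hf.mono (by exact_mod_cast hss)) h2
    rw [Finset.card_insert_of_notMem hxT] at hS
    rcases Nat.lt_or_ge T.card 2 with h1 | h2
    · obtain ⟨t, rfl⟩ := Finset.card_eq_one.1 (show T.card = 1 by omega)
      have htx := hTx t (by simp)
      rcases lt_or_gt_of_ne (hfx t (by simp)) with h | h
      · exact Or.inl ⟨{t}, {x}, by simp, by simp, by ext; simp; tauto, by simp [htx, h]⟩
      · exact Or.inr ⟨{t}, {x}, by simp, by simp, by ext; simp; tauto, by simp [htx, h]⟩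
    · rcases ihT T subset_rfl h2 with h | h
      · exact h.insert_max hTx hfx ihT hav
      · have := h.insert_max hTx (fun s hs => by simpa using hfx s hs)
          (fun R hR h2 => by rw [neg_neg]; exact (ihT R hR h2).symm) hav.neg
        rw [neg_neg] at this
        exact this.symm

/-! ### Twins in separable permutations -/

/-- `x` and `y` are consecutive elements of `S`, and their values are consecutive values. -/
def Twins (f : ℕ → ℤ) (S : Finset ℕ) (x y : ℕ) : Prop :=
  x ∈ S ∧ y ∈ S ∧ x < y ∧ ∀ z ∈ S, ¬ (x < z ∧ z < y) ∧
    ¬ (f x < f z ∧ f z < f y) ∧ ¬ (f y < f z ∧ f z < f x)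

theorem Twins.neg {f : ℕ → ℤ} {S : Finset ℕ} {x y : ℕ} (h : Twins (-f) S x y) :
    Twins f S x y := by
  obtain ⟨hx, hy, hxy, h⟩ := h
  refine ⟨hx, hy, hxy, fun z hz => ?_⟩
  have := h z hz
  simp only [Pi.neg_apply, neg_lt_neg_iff] at this
  tauto

/-- Twins of one part remain twins in `S`, since the other part lies entirely to one side in
position and in value. If both parts are singletons, these are twins. -/
theorem SumDecomposes.exists_twins {f : ℕ → ℤ} {S : Finset ℕ} (h : SumDecomposes f S)
    (ih : ∀ T ⊂ S, 2 ≤ T.card → ∃ x y, Twins f T x y) : ∃ x y, Twins f S x y := by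
  obtain ⟨A, B, hA, hB, rfl, hlt⟩ := h
  have hdis : ∀ a ∈ A, a ∉ B := fun a ha hb => lt_irrefl a (hlt a ha a hb).1
  by_cases hA2 : 2 ≤ A.card
  · obtain ⟨b, hb⟩ := hB
    obtain ⟨x, y, hx, hy, hxy, h⟩ := ih A ⟨Finset.subset_union_left, fun hs =>
      hdis b (hs (by simp [hb])) hb⟩ hA2
    refine ⟨x, y, by simp [hx], by simp [hy], hxy, fun z hz => ?_⟩
    rcases Finset.mem_union.1 hz with hz | hz
    · exact h z hz
    · have := hlt x hx z hz
      have := hlt y hy z hz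
      omega
  by_cases hB2 : 2 ≤ B.card
  · obtain ⟨a, ha⟩ := hA
    obtain ⟨x, y, hx, hy, hxy, h⟩ := ih B ⟨Finset.subset_union_right, fun hs =>
      hdis a ha (hs (by simp [ha]))⟩ hB2
    refine ⟨x, y, by simp [hx], by simp [hy], hxy, fun z hz => ?_⟩
    rcases Finset.mem_union.1 hz with hz | hz
    · have := hlt z hz x hx
      have := hlt z hz y hy
      omega
    · exact h z hz
  have h1 := hA.card_pos
  have h2 := hB.card_pos
  obtain ⟨a, rfl⟩ := Finset.card_eq_one.1 (show A.card = 1 by omega)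
  obtain ⟨b, rfl⟩ := Finset.card_eq_one.1 (show B.card = 1 by omega)
  refine ⟨a, b, by simp, by simp, (hlt a (by simp) b (by simp)).1, fun z hz => ?_⟩
  rcases Finset.mem_union.1 hz with hz | hz <;> rw [Finset.mem_singleton.1 hz] <;> omega

theorem AvoidsPatterns.exists_twins {f : ℕ → ℤ} {S : Finset ℕ} (hav : AvoidsPatterns f S)
    (hf : Set.InjOn f S) (hS : 2 ≤ S.card) : ∃ x y, Twins f S x y := by
  induction S using Finset.strongInduction with
  | H S ih =>
    have ih' : ∀ T ⊂ S, 2 ≤ T.card → ∃ x y, Twins f T x y := fun T hT h2 =>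
      ih T hT (hav.mono hT.1) (hf.mono (by exact_mod_cast hT.1)) h2
    rcases hav.sumDecomposes hf hS with h | h
    · exact h.exists_twins ih'
    · obtain ⟨x, y, hxy⟩ := h.exists_twins fun T hT h2 => by
        obtain ⟨x, y, h⟩ := ih' T hT h2
        exact ⟨x, y, Twins.neg (by rwa [neg_neg])⟩
      exact ⟨x, y, hxy.neg⟩

/-! ### Subdivisions, parametrised cycles and their arcs -/

variable {V W : Type*}

/-- To exhibit a subdivision of `K` it suffices to give the paths for one orientation `R` of `K`. -/
theorem isSubdivisionOf_of_orientation {H : SimpleGraph V} {K : SimpleGraph W} (R : W → W → Prop)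
    (hR : ∀ x y, K.Adj x y ↔ R x y ∨ R y x) (hasymm : ∀ x y, R x y → ¬ R y x)
    (b : W ↪ V) (q : ∀ x y, R x y → H.Walk (b x) (b y))
    (hpath : ∀ x y h, (q x y h).IsPath)
    (hinner : ∀ x y h, ∀ v ∈ (q x y h).support, v ≠ b x → v ≠ b y →
      v ∉ Set.range b ∧ ∀ x' y' h', v ∈ (q x' y' h').support → x = x' ∧ y = y')
    (hvert : ∀ v, v ∈ Set.range b ∨ ∃ x y h, v ∈ (q x y h).support)
    (hedge : ∀ f ∈ H.edgeSet, ∃ x y h, f ∈ (q x y h).edges) :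
    IsSubdivisionOf H K := by
  classical
  let p : ∀ x y : W, K.Adj x y → H.Walk (b x) (b y) := fun x y h =>
    if hxy : R x y then q x y hxy else (q y x (((hR x y).1 h).resolve_left hxy)).reverse
  have hpos : ∀ x y (h : R x y), p x y ((hR x y).2 (.inl h)) = q x y h := fun x y h => by
    simp [p, h]
  have hneg : ∀ x y (h : R y x), p x y ((hR x y).2 (.inr h)) = (q y x h).reverse :=
    fun x y h => by simp [p, hasymm _ _ h]
  have hsupp : ∀ x y (h : K.Adj x y) v, v ∈ (p x y h).support →
      ∃ x' y' h', v ∈ (q x' y' h').support ∧ ((x = x' ∧ y = y') ∨ (x = y' ∧ y = x')) := by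
    intro x y h v hv
    rcases (hR x y).1 h with h' | h'
    · rw [hpos x y h'] at hv
      exact ⟨x, y, h', hv, by simp⟩
    · rw [hneg x y h', SimpleGraph.Walk.support_reverse, List.mem_reverse] at hv
      exact ⟨y, x, h', hv, by simp⟩
  refine ⟨b, p, fun x y h => ?_, fun x y h => ?_, fun x y h v hv hx hy => ?_, fun v => ?_,
    fun f hf => ?_⟩
  · rcases (hR x y).1 h with h' | h'
    · rw [hpos x y h']
      exact hpath _ _ _
    · rw [hneg x y h']
      exact (hpath _ _ _).reverse
  · rcases (hR x y).1 h with h' | h'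
    · rw [hpos x y h', hneg y x h']
    · rw [hneg x y h', hpos y x h', SimpleGraph.Walk.reverse_reverse]
  · obtain ⟨x', y', h', hv', hxy⟩ := hsupp x y h v hv
    have hin := hinner x' y' h' v hv' (by rcases hxy with ⟨rfl, rfl⟩ | ⟨rfl, rfl⟩ <;> assumption)
      (by rcases hxy with ⟨rfl, rfl⟩ | ⟨rfl, rfl⟩ <;> assumption)
    refine ⟨hin.1, fun x₂ y₂ h₂ hv₂ => ?_⟩
    obtain ⟨x₃, y₃, h₃, hv₃, hxy₃⟩ := hsupp x₂ y₂ h₂ v hv₂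
    obtain ⟨rfl, rfl⟩ := hin.2 x₃ y₃ h₃ hv₃
    rcases hxy with ⟨rfl, rfl⟩ | ⟨rfl, rfl⟩ <;> rcases hxy₃ with ⟨rfl, rfl⟩ | ⟨rfl, rfl⟩ <;>
      simp [Sym2.eq_swap]
  · refine (hvert v).imp_right ?_
    rintro ⟨x, y, h, hv⟩
    exact ⟨x, y, (hR x y).2 (.inl h), by rwa [hpos]⟩
  · obtain ⟨x, y, h, hv⟩ := hedge f hf
    exact ⟨x, y, (hR x y).2 (.inl h), by rwa [hpos]⟩

/-- `g 0, g 1, …, g n = g 0` runs once around a closed trail of length `n` in `C`. -/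
structure IsCyclicParam (C : SimpleGraph V) (g : ℕ → V) (n : ℕ) : Prop where
  inj : ∀ s t, s < n → t < n → g s = g t → s = t
  closes : g n = g 0
  adj : ∀ t < n, C.Adj (g t) (g (t + 1))

theorem IsCyclicParam.mono {C H : SimpleGraph V} {g : ℕ → V} {n : ℕ} (hg : IsCyclicParam C g n)
    (h : C ≤ H) : IsCyclicParam H g n :=
  ⟨hg.inj, hg.closes, fun t ht => h (hg.adj t ht)⟩

theorem IsCyclicParam.eq_or {C : SimpleGraph V} {g : ℕ → V} {n : ℕ} (hg : IsCyclicParam C g n)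
    {s t : ℕ} (hs : s ≤ n) (ht : t ≤ n) (h : g s = g t) :
    s = t ∨ (s = 0 ∧ t = n) ∨ (s = n ∧ t = 0) := by
  by_contra hne
  rcases hs.lt_or_eq with hs | rfl <;> rcases ht.lt_or_eq with ht | rfl
  · exact hne (.inl (hg.inj s t hs ht h))
  · rw [hg.closes] at h
    have := hg.inj s 0 hs (by omega) h
    omega
  · rw [hg.closes] at h
    have := hg.inj 0 t (by omega) ht h
    omega
  · omega

theorem IsCyclicParam.reverse {C : SimpleGraph V} {g : ℕ → V} {n : ℕ} (hg : IsCyclicParam C g n) :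
    IsCyclicParam C (fun t => g (n - t)) n where
  inj s t hs ht h := by
    have := hg.eq_or (n.sub_le s) (n.sub_le t) h
    omega
  closes := by simp [hg.closes]
  adj t ht := by
    have := (hg.adj (n - (t + 1)) (by omega)).symm
    rwa [show n - (t + 1) + 1 = n - t by omega] at this

/-- The bound `k < n` keeps the arc from closing up, which would stop it from being a path. -/
theorem IsCyclicParam.exists_arc {C : SimpleGraph V} {g : ℕ → V} {n : ℕ}
    (hg : IsCyclicParam C g n) (k : ℕ) : ∀ a b, a + k = b → b ≤ n → k < n →
    ∃ q : C.Walk (g a) (g b), q.IsPath ∧ (∀ v, v ∈ q.support ↔ ∃ t, a ≤ t ∧ t ≤ b ∧ v = g t) ∧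
      ∀ t, a ≤ t → t < b → s(g t, g (t + 1)) ∈ q.edges := by
  induction k with
  | zero =>
    rintro a _ rfl hb hk
    refine ⟨.nil, .nil, fun v => ⟨fun hv => ⟨a, by simp_all⟩, ?_⟩, fun t _ _ => by omega⟩
    rintro ⟨t, h1, h2, rfl⟩
    obtain rfl : t = a := by omega
    simp
  | succ k ih =>
    intro a b hab hb hk
    obtain ⟨q, hq, hs, he⟩ := ih (a + 1) b (by omega) hb (by omega)
    refine ⟨.cons (hg.adj a (by omega)) q, ?_, fun v => ?_, fun t h1 h2 => ?_⟩
    · rw [SimpleGraph.Walk.cons_isPath_iff]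
      refine ⟨hq, fun h => ?_⟩
      obtain ⟨t, h1, h2, h3⟩ := (hs _).1 h
      have := hg.eq_or (by omega) (by omega) h3
      omega
    · rw [SimpleGraph.Walk.support_cons, List.mem_cons, hs]
      constructor
      · rintro (rfl | ⟨t, h1, h2, rfl⟩)
        · exact ⟨a, le_rfl, by omega, rfl⟩
        · exact ⟨t, by omega, h2, rfl⟩
      · rintro ⟨t, h1, h2, rfl⟩
        rcases h1.eq_or_lt with rfl | h1
        · exact .inl rfl
        · exact .inr ⟨t, h1, h2, rfl⟩
    · rw [SimpleGraph.Walk.edges_cons, List.mem_cons]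
      rcases h1.eq_or_lt with rfl | h1
      · exact .inl rfl
      · exact .inr (he t h1 h2)

theorem exists_mem_arc {c : ℕ → ℕ} (h0 : c 0 = 0) {t : ℕ} :
    ∀ k, t < c k → ∃ i < k, c i ≤ t ∧ t < c (i + 1)
  | 0, h => by omega
  | k + 1, h => by
    rcases Nat.lt_or_ge t (c k) with h' | h'
    · obtain ⟨i, hi, h1⟩ := exists_mem_arc h0 k h'
      exact ⟨i, by omega, h1⟩
    · exact ⟨k, by omega, h', h⟩

/-- Five points of a cycle divide it into five arcs. -/
theorem IsCyclicParam.exists_five_arcs {C : SimpleGraph V} {g : ℕ → V} {n : ℕ}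
    (hg : IsCyclicParam C g n) {c : ℕ → ℕ} (h0 : c 0 = 0) (h5 : c 5 = n)
    (hc : StrictMonoOn c (Set.Iic 5)) :
    ∃ q : ∀ i : ZMod 5, C.Walk (g (c i.val)) (g (c (i + 1).val)),
      (∀ i, (q i).IsPath) ∧
      (∀ i, ∀ v ∈ (q i).support, ∃ t, v = g t) ∧
      (∀ i, ∀ v ∈ (q i).support, v ≠ g (c i.val) → v ≠ g (c (i + 1).val) →
        (∀ j : ZMod 5, v ≠ g (c j.val)) ∧ ∀ j, v ∈ (q j).support → i = j) ∧
      (∀ t < n, ∃ i, g t ∈ (q i).support) ∧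
      ∀ t < n, ∃ i, s(g t, g (t + 1)) ∈ (q i).edges := by
  have hlt : ∀ i j, i < j → j ≤ 5 → c i < c j := fun i j h h5 =>
    hc (by simp; omega) (by simpa using h5) h
  have hle : ∀ i j, i ≤ j → j ≤ 5 → c i ≤ c j := fun i j h h5 => by
    rcases h.eq_or_lt with rfl | h
    · rfl
    · exact (hlt i j h h5).le
  have hval : ∀ i : ZMod 5, i.val < 5 := ZMod.val_lt
  -- The last arc ends at index `c 5 = n`, which is the same vertex as index `c 0 = 0`.
  have hnext : ∀ i : ZMod 5, g (c (i + 1).val) = g (c (i.val + 1)) := by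
    have : ∀ i : ZMod 5, (i + 1).val = i.val + 1 ∨ (i.val = 4 ∧ (i + 1).val = 0) := by decide
    intro i
    rcases this i with h | ⟨h, h'⟩
    · rw [h]
    · rw [h, h', h0, h5, hg.closes]
  have hbd : ∀ i : ZMod 5, c (i.val + 1) ≤ n := fun i => by
    rw [← h5]
    exact hle _ _ (hval i) le_rfl
  have hbd' : ∀ i : ZMod 5, c i.val < n := fun i => by
    rw [← h5]
    exact hlt _ _ (hval i) le_rfl
  have hstep : ∀ i : ZMod 5, c i.val < c (i.val + 1) := fun i =>
    hlt _ _ (Nat.lt_succ_self _) (hval i)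
  -- An arc of full length would have to be the first one, with `c 1 = n = c 5`.
  have hlen : ∀ i : ZMod 5, c (i.val + 1) - c i.val < n := fun i => by
    by_contra hcon
    have h1 := hbd i
    have h2 := hstep i
    have h3 : c i.val = 0 := by omega
    have h4 : c (i.val + 1) = n := by omega
    have hi : i.val = 0 := by
      by_contra hi
      have := hlt 0 i.val (by omega) (hval i).le
      omega
    rw [hi] at h4
    have := hlt 1 5 (by omega) le_rfl
    simp only [zero_add] at h4
    omega
  choose q hpath hsupp hedge using fun i : ZMod 5 =>
    hg.exists_arc (c (i.val + 1) - c i.val) (c i.val) (c (i.val + 1)) (by have := hstep i; omega)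
      (hbd i) (hlen i)
  have harc : ∀ t < n, ∃ i : ZMod 5, c i.val ≤ t ∧ t < c (i.val + 1) := fun t ht => by
    obtain ⟨k, hk, h⟩ := exists_mem_arc h0 5 (h5.symm ▸ ht)
    refine ⟨(k : ZMod 5), ?_⟩
    rwa [ZMod.val_natCast, Nat.mod_eq_of_lt hk]
  refine ⟨fun i => (q i).copy rfl (hnext i).symm, fun i => by simpa using hpath i,
    fun i v hv => ?_, fun i v hv h1 h2 => ?_, fun t ht => ?_, fun t ht => ?_⟩
  · obtain ⟨t, -, -, h⟩ := (hsupp i v).1 (by simpa using hv)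
    exact ⟨t, h⟩
  · obtain ⟨t, ht1, ht2, rfl⟩ := (hsupp i v).1 (by simpa using hv)
    rw [hnext] at h2
    have ht1 := lt_of_le_of_ne ht1 (fun h => h1 (by rw [h]))
    have ht2 := lt_of_le_of_ne ht2 (fun h => h2 (by rw [h]))
    have htn := hbd i
    -- As `t` is strictly inside its arc, `0 < t < n`, so the coincidence `g 0 = g n` cannot
    -- interfere.
    have key : ∀ j : ZMod 5, ∀ s, c j.val ≤ s → s ≤ c (j.val + 1) → g t = g s → i = j ∧ t = s := by
      intro j s hs1 hs2 hts
      have hsn := hbd j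
      have hts : t = s := by
        have := hg.eq_or (by omega) (by omega) hts
        omega
      subst hts
      refine ⟨ZMod.val_injective 5 ?_, rfl⟩
      rcases lt_trichotomy i.val j.val with h | h | h
      · have := hle (i.val + 1) j.val h (hval j).le
        omega
      · exact h
      · have := hle (j.val + 1) i.val h (hval i).le
        omega
    refine ⟨fun j hj => ?_, fun j hj => ?_⟩
    · obtain ⟨rfl, h⟩ := key j (c j.val) le_rfl (hstep j).le hj
      omega
    · obtain ⟨s, hs1, hs2, hs⟩ := (hsupp j _).1 (by simpa using hj)
      exact (key j s hs1 hs2 hs).1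
  · obtain ⟨i, h1, h2⟩ := harc t ht
    exact ⟨i, by simpa using (hsupp i _).2 ⟨t, h1, h2.le, rfl⟩⟩
  · obtain ⟨i, h1, h2⟩ := harc t ht
    exact ⟨i, by simpa using hedge i t h1 h2⟩

/-- `g` and `h` run around disjoint cycles which together make up the graph `C`. -/
structure IsTwoCycleParam (C : SimpleGraph V) (g : ℕ → V) (m : ℕ) (h : ℕ → V) (n : ℕ) :
    Prop where
  left : IsCyclicParam C g m
  right : IsCyclicParam C h n
  disjoint : ∀ s t, g s ≠ h t
  cover : ∀ v, (∃ t < m, v = g t) ∨ ∃ t < n, v = h t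
  edges : ∀ x y, C.Adj x y →
    (∃ t < m, s(x, y) = s(g t, g (t + 1))) ∨ ∃ t < n, s(x, y) = s(h t, h (t + 1))

theorem IsTwoCycleParam.reverse_right {C : SimpleGraph V} {g h : ℕ → V} {m n : ℕ}
    (H : IsTwoCycleParam C g m h n) : IsTwoCycleParam C g m (fun t => h (n - t)) n where
  left := H.left
  right := H.right.reverse
  disjoint s t := H.disjoint s _
  cover v := by
    refine (H.cover v).imp_right ?_
    rintro ⟨t, ht, rfl⟩
    -- Index `0` is separate because `n - 0` is outside the range `t < n`.
    rcases Nat.eq_zero_or_pos t with rfl | h0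
    · exact ⟨0, ht, by simp [H.right.closes]⟩
    · exact ⟨n - t, by omega, by rw [Nat.sub_sub_self ht.le]⟩
  edges x y hxy := by
    refine (H.edges x y hxy).imp_right ?_
    rintro ⟨t, ht, h⟩
    refine ⟨n - (t + 1), by omega, ?_⟩
    rw [Nat.sub_sub_self (by omega), show n - (n - (t + 1) + 1) = t by omega, h, Sym2.eq_swap]

/-! ### Petersen subdivisions from two cycles and five spokes -/

/-- An orientation of the Petersen graph. -/
def PetersenArc : ZMod 5 ⊕ ZMod 5 → ZMod 5 ⊕ ZMod 5 → Prop
  | Sum.inl i, Sum.inl j => j = i + 1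
  | Sum.inr i, Sum.inr j => j = i + 2
  | Sum.inl i, Sum.inr j => i = j
  | Sum.inr _, Sum.inl _ => False

theorem petersenGraph_adj_iff (x y : ZMod 5 ⊕ ZMod 5) :
    petersenGraph.Adj x y ↔ PetersenArc x y ∨ PetersenArc y x := by
  rcases x with i | i <;> rcases y with j | j <;> simp [petersenGraph, PetersenArc, eq_comm]

theorem PetersenArc.asymm (x y : ZMod 5 ⊕ ZMod 5) (h : PetersenArc x y) : ¬ PetersenArc y x := by
  rcases x with i | i <;> rcases y with j | j
  · revert i j
    simp only [PetersenArc]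
    decide
  · simp [PetersenArc]
  · exact h.elim
  · revert i j
    simp only [PetersenArc]
    decide

theorem petersenArc_outer (i : ZMod 5) : PetersenArc (Sum.inl i) (Sum.inl (i + 1)) := rfl

/-- Doubling lists the inner vertices in the order in which the pentagram visits them. Its inverse
modulo 5 is multiplication by 3, so `Sum.inr i` is number `3 * i` on the inner cycle. -/
theorem petersenArc_inner (i : ZMod 5) :
    PetersenArc (Sum.inr (2 * i)) (Sum.inr (2 * (i + 1))) := by
  simp only [PetersenArc]
  ring

theorem petersenArc_spoke (i : ZMod 5) : PetersenArc (Sum.inl i) (Sum.inr i) := rfl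

theorem PetersenArc.cases {x y : ZMod 5 ⊕ ZMod 5} (h : PetersenArc x y) :
    (∃ i, x = Sum.inl i ∧ y = Sum.inl (i + 1)) ∨
      (∃ i, x = Sum.inr (2 * i) ∧ y = Sum.inr (2 * (i + 1))) ∨
      ∃ i, x = Sum.inl i ∧ y = Sum.inr i := by
  have h1 : ∀ i : ZMod 5, i = 2 * (3 * i) := by decide
  have h2 : ∀ i : ZMod 5, i + 2 = 2 * (3 * i + 1) := by decide
  rcases x with i | i <;> rcases y with j | j
  · exact .inl ⟨i, rfl, congrArg _ h⟩
  · exact .inr (.inr ⟨i, rfl, congrArg _ (Eq.symm h)⟩)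
  · exact h.elim
  · exact .inr (.inl ⟨3 * i, congrArg _ (h1 i), congrArg _ (Eq.trans h (h2 i))⟩)

/-- Two cycles with five spokes, whose ends are in the cyclic order of the Petersen graph. -/
theorem IsTwoCycleParam.isSubdivisionOf_petersenGraph {C H : SimpleGraph V} {g h : ℕ → V}
    {m n : ℕ} (P : IsTwoCycleParam C g m h n) {c d : ℕ → ℕ}
    (hc0 : c 0 = 0) (hc5 : c 5 = m) (hc : StrictMonoOn c (Set.Iic 5))
    (hd0 : d 0 = 0) (hd5 : d 5 = n) (hd : StrictMonoOn d (Set.Iic 5))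
    (hCH : C ≤ H) (hspoke : ∀ i : ZMod 5, H.Adj (g (c i.val)) (h (d (3 * i).val)))
    (hH : ∀ x y, H.Adj x y → C.Adj x y ∨ ∃ i : ZMod 5, s(x, y) = s(g (c i.val), h (d (3 * i).val))) :
    IsSubdivisionOf H petersenGraph := by
  obtain ⟨q, hq1, hq2, hq3, hq4, hq5⟩ := (P.left.mono hCH).exists_five_arcs hc0 hc5 hc
  obtain ⟨r, hr1, hr2, hr3, hr4, hr5⟩ := (P.right.mono hCH).exists_five_arcs hd0 hd5 hd
  have hci : ∀ i j : ZMod 5, g (c i.val) = g (c j.val) → i = j := fun i j hij => by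
    have hm : ∀ i : ZMod 5, c i.val < m := fun i =>
      hc5 ▸ hc (by simpa using (ZMod.val_lt i).le) (by simp) (ZMod.val_lt i)
    exact ZMod.val_injective 5 (hc.injOn (by simpa using (ZMod.val_lt i).le)
      (by simpa using (ZMod.val_lt j).le) (P.left.inj _ _ (hm i) (hm j) hij))
  have hdi : ∀ i j : ZMod 5, h (d i.val) = h (d j.val) → i = j := fun i j hij => by
    have hm : ∀ i : ZMod 5, d i.val < n := fun i =>
      hd5 ▸ hd (by simpa using (ZMod.val_lt i).le) (by simp) (ZMod.val_lt i)
    exact ZMod.val_injective 5 (hd.injOn (by simpa using (ZMod.val_lt i).le)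
      (by simpa using (ZMod.val_lt j).le) (P.right.inj _ _ (hm i) (hm j) hij))
  have h23 : ∀ i : ZMod 5, 3 * (2 * i) = i := by decide
  have h32 : ∀ i : ZMod 5, 2 * (3 * i) = i := by decide
  have h2 : ∀ i j : ZMod 5, 2 * i = 2 * j → i = j := by decide
  obtain ⟨b, hbl, hbr⟩ : ∃ b : ZMod 5 ⊕ ZMod 5 ↪ V, (∀ i, b (Sum.inl i) = g (c i.val)) ∧
      ∀ i, b (Sum.inr (2 * i)) = h (d i.val) := by
    refine ⟨⟨Sum.elim (fun i => g (c i.val)) (fun i => h (d (3 * i).val)), ?_⟩,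
      fun i => rfl, fun i => ?_⟩
    · rintro (i | i) (j | j) hij
      · rw [hci i j hij]
      · exact (P.disjoint _ _ hij).elim
      · exact (P.disjoint _ _ hij.symm).elim
      · rw [← h32 i, hdi _ _ hij, h32]
    · change h (d (3 * (2 * i)).val) = _
      rw [h23]
  have hbr' : ∀ i, b (Sum.inr i) = h (d (3 * i).val) := fun i => by rw [← hbr, h32]
  -- Recording supports and edge lists here avoids later transport of walks along equalities of
  -- their ends.
  have hex : ∀ x y, PetersenArc x y → ∃ p : H.Walk (b x) (b y), p.IsPath ∧
      (∀ i, x = Sum.inl i → y = Sum.inl (i + 1) →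
        p.support = (q i).support ∧ p.edges = (q i).edges) ∧
      (∀ i, x = Sum.inr (2 * i) → y = Sum.inr (2 * (i + 1)) →
        p.support = (r i).support ∧ p.edges = (r i).edges) ∧
      (∀ i, x = Sum.inl i → y = Sum.inr i →
        p.support = [b (Sum.inl i), b (Sum.inr i)] ∧
          p.edges = [s(b (Sum.inl i), b (Sum.inr i))]) := by
    intro x y hxy
    rcases hxy.cases with ⟨i, rfl, rfl⟩ | ⟨i, rfl, rfl⟩ | ⟨i, rfl, rfl⟩
    · refine ⟨(q i).copy (hbl _).symm (hbl _).symm, by simpa using hq1 i, ?_, by simp, by simp⟩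
      rintro j ⟨⟩ -
      simp
    · refine ⟨(r i).copy (hbr _).symm (hbr _).symm, by simpa using hr1 i, by simp, ?_, by simp⟩
      rintro j hj -
      obtain rfl := h2 _ _ (Sum.inr_injective hj)
      simp
    · have hadj : H.Adj (b (Sum.inl i)) (b (Sum.inr i)) := by
        rw [hbl, hbr']
        exact hspoke i
      refine ⟨.cons hadj .nil, by simp, by simp, by simp, ?_⟩
      rintro j ⟨⟩ -
      simp
  choose p hpath hpl hpr hps using hex
  refine isSubdivisionOf_of_orientation PetersenArc petersenGraph_adj_iff PetersenArc.asymm b p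
    hpath ?_ ?_ ?_
  · have hall : ∀ x y hxy, ∀ v ∈ (p x y hxy).support, (v = b x ∨ v = b y) ∨
        (∃ i, x = Sum.inl i ∧ y = Sum.inl (i + 1) ∧ v ∈ (q i).support) ∨
        (∃ i, x = Sum.inr (2 * i) ∧ y = Sum.inr (2 * (i + 1)) ∧ v ∈ (r i).support) := by
      intro x y hxy v hv
      rcases hxy.cases with ⟨i, rfl, rfl⟩ | ⟨i, rfl, rfl⟩ | ⟨i, rfl, rfl⟩
      · rw [(hpl _ _ hxy i rfl rfl).1] at hv
        exact .inr (.inl ⟨i, rfl, rfl, hv⟩)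
      · rw [(hpr _ _ hxy i rfl rfl).1] at hv
        exact .inr (.inr ⟨i, rfl, rfl, hv⟩)
      · rw [(hps _ _ hxy i rfl rfl).1] at hv
        simpa using hv
    intro x y hxy v hv hx hy
    rcases hall x y hxy v hv with h' | ⟨i, rfl, rfl, hvi⟩ | ⟨i, rfl, rfl, hvi⟩
    · tauto
    · rw [hbl] at hx hy
      obtain ⟨h4, h5⟩ := hq3 i v hvi hx hy
      obtain ⟨t, rfl⟩ := hq2 i v hvi
      have hrange : g t ∉ Set.range b := by
        rintro ⟨k | k, hk⟩
        · exact h4 k (by rw [← hbl, hk])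
        · rw [hbr'] at hk
          exact P.disjoint _ _ hk.symm
      refine ⟨hrange, fun x' y' hxy' hv' => ?_⟩
      rcases hall x' y' hxy' _ hv' with (h' | h') | ⟨j, rfl, rfl, hvj⟩ | ⟨j, rfl, rfl, hvj⟩
      · exact (hrange ⟨_, h'.symm⟩).elim
      · exact (hrange ⟨_, h'.symm⟩).elim
      · simp [h5 j hvj]
      · obtain ⟨s, hs⟩ := hr2 _ _ hvj
        exact (P.disjoint _ _ hs).elim
    · rw [hbr] at hx hy
      obtain ⟨h4, h5⟩ := hr3 i v hvi hx hy
      obtain ⟨t, rfl⟩ := hr2 i v hvi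
      have hrange : h t ∉ Set.range b := by
        rintro ⟨k | k, hk⟩
        · rw [hbl] at hk
          exact P.disjoint _ _ hk
        · exact h4 (3 * k) (by rw [← hbr', hk])
      refine ⟨hrange, fun x' y' hxy' hv' => ?_⟩
      rcases hall x' y' hxy' _ hv' with (h' | h') | ⟨j, rfl, rfl, hvj⟩ | ⟨j, rfl, rfl, hvj⟩
      · exact (hrange ⟨_, h'.symm⟩).elim
      · exact (hrange ⟨_, h'.symm⟩).elim
      · obtain ⟨s, hs⟩ := hq2 _ _ hvj
        exact (P.disjoint _ _ hs.symm).elim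
      · simp [h5 j hvj]
  · intro v
    right
    rcases P.cover v with ⟨t, ht, rfl⟩ | ⟨t, ht, rfl⟩
    · obtain ⟨i, hi⟩ := hq4 t ht
      exact ⟨_, _, petersenArc_outer i, by rwa [(hpl _ _ _ i rfl rfl).1]⟩
    · obtain ⟨i, hi⟩ := hr4 t ht
      exact ⟨_, _, petersenArc_inner i, by rwa [(hpr _ _ _ i rfl rfl).1]⟩
  · intro f
    induction f with
    | h x y =>
      intro hxy
      rcases hH x y hxy with hxy | ⟨i, hi⟩
      · rcases P.edges x y hxy with ⟨t, ht, e⟩ | ⟨t, ht, e⟩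
        · obtain ⟨i, hi⟩ := hq5 t ht
          exact ⟨_, _, petersenArc_outer i, by rwa [(hpl _ _ _ i rfl rfl).2, e]⟩
        · obtain ⟨i, hi⟩ := hr5 t ht
          exact ⟨_, _, petersenArc_inner i, by rwa [(hpr _ _ _ i rfl rfl).2, e]⟩
      · refine ⟨_, _, petersenArc_spoke i, ?_⟩
        rw [(hps _ _ _ i rfl rfl).2, hi, hbl, hbr', List.mem_singleton]

/-! ### Traversing the two cycles from chosen vertices -/

open scoped Fin.CommRing in
theorem exists_cycleGraph_param {m : ℕ} (hm : 3 ≤ m) (i₀ : Fin m) : ∃ g : ℕ → Fin m, g 0 = i₀ ∧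
    IsCyclicParam (SimpleGraph.cycleGraph m) g m ∧ (∀ i, ∃ t < m, i = g t) ∧
    ∀ i j, (SimpleGraph.cycleGraph m).Adj i j → ∃ t < m, s(i, j) = s(g t, g (t + 1)) := by
  obtain ⟨k, rfl⟩ : ∃ k, m = k + 2 := ⟨m - 2, by omega⟩
  have hcover : ∀ i, ∃ t < k + 2, i = i₀ + (t : Fin (k + 2)) := fun i =>
    ⟨(i - i₀).val, (i - i₀).isLt, by simp⟩
  -- Adjacency in the cycle graph means a difference of `±1` modulo its length, so adding `1`
  -- repeatedly runs around it.
  refine ⟨fun t => i₀ + (t : Fin (k + 2)), by simp, ⟨?_, ?_, ?_⟩, hcover, ?_⟩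
  · intro s t hs ht h
    have := congrArg Fin.val (add_left_cancel h)
    rwa [Fin.val_cast_of_lt hs, Fin.val_cast_of_lt ht] at this
  · simp
  · intro t _
    rw [SimpleGraph.cycleGraph_adj]
    right
    push_cast
    abel
  · intro i j h
    rw [SimpleGraph.cycleGraph_adj] at h
    rcases h with h | h
    · obtain ⟨t, ht, rfl⟩ := hcover j
      refine ⟨t, ht, ?_⟩
      rw [sub_eq_iff_eq_add.1 h, Sym2.eq_swap]
      push_cast
      rw [add_comm 1, add_assoc]
    · obtain ⟨t, ht, rfl⟩ := hcover i
      refine ⟨t, ht, ?_⟩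
      rw [sub_eq_iff_eq_add.1 h]
      push_cast
      rw [add_comm 1, add_assoc]

theorem IsCyclicParam.map {C : SimpleGraph W} {D : SimpleGraph V} {g : ℕ → W} {n : ℕ}
    (hg : IsCyclicParam C g n) (φ : C ↪g D) : IsCyclicParam D (fun t => φ (g t)) n where
  inj s t hs ht h := hg.inj s t hs ht (φ.injective h)
  closes := by simp [hg.closes]
  adj t ht := φ.map_adj_iff.2 (hg.adj t ht)

/-- The two cycles of a disjoint sum of cycle graphs can be traversed from any given vertices. -/
theorem exists_isTwoCycleParam {C : SimpleGraph V} {m n : ℕ} (hm : 3 ≤ m) (hn : 3 ≤ n)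
    (φ : SimpleGraph.cycleGraph m ⊕g SimpleGraph.cycleGraph n ≃g C) (i : Fin m) (j : Fin n) :
    ∃ (g : ℕ → Fin m) (h : ℕ → Fin n), g 0 = i ∧ h 0 = j ∧
      IsTwoCycleParam C (fun t => φ (Sum.inl (g t))) m (fun t => φ (Sum.inr (h t))) n := by
  obtain ⟨g, hg0, hg, hgc, hge⟩ := exists_cycleGraph_param hm i
  obtain ⟨h, hh0, hh, hhc, hhe⟩ := exists_cycleGraph_param hn j
  refine ⟨g, h, hg0, hh0, hg.map (φ.toEmbedding.comp SimpleGraph.Embedding.sumInl),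
    hh.map (φ.toEmbedding.comp SimpleGraph.Embedding.sumInr), fun s t hst => ?_, fun v => ?_,
    fun x y hxy => ?_⟩
  · exact Sum.inl_ne_inr (φ.injective hst)
  · obtain ⟨a | a, rfl⟩ := φ.surjective v
    · obtain ⟨t, ht, rfl⟩ := hgc a
      exact .inl ⟨t, ht, rfl⟩
    · obtain ⟨t, ht, rfl⟩ := hhc a
      exact .inr ⟨t, ht, rfl⟩
  · obtain ⟨a | a, rfl⟩ := φ.surjective x <;> obtain ⟨b | b, rfl⟩ := φ.surjective y <;>
      rw [φ.map_adj_iff] at hxy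
    · obtain ⟨t, ht, e⟩ := hge a b hxy
      exact .inl ⟨t, ht, congrArg (Sym2.map fun a => φ (Sum.inl a)) e⟩
    · simp at hxy
    · simp at hxy
    · obtain ⟨t, ht, e⟩ := hhe a b hxy
      exact .inr ⟨t, ht, congrArg (Sym2.map fun a => φ (Sum.inr a)) e⟩

/-! ### `M`-copies of the Petersen graph and of `C₄` -/

/-- Four edges of `M` in the pattern `3142` form a copy of the Petersen graph with the edge of `M`
at the start of both cycles. -/
theorem IsTwoCycleParam.exists_isMP10 {G : SimpleGraph V} {M : G.Subgraph} {g h : ℕ → V} {m n : ℕ}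
    (P : IsTwoCycleParam (G.deleteEdges M.edgeSet) g m h n) {a₁ a₂ a₃ a₄ b₁ b₂ b₃ b₄ : ℕ}
    (ha₁ : 0 < a₁) (ha₂ : a₁ < a₂) (ha₃ : a₂ < a₃) (ha₄ : a₃ < a₄) (ham : a₄ < m)
    (hb₁ : 0 < b₁) (hb₂ : b₁ < b₂) (hb₃ : b₂ < b₃) (hb₄ : b₃ < b₄) (hbn : b₄ < n)
    (h0 : M.Adj (g 0) (h 0)) (h1 : M.Adj (g a₁) (h b₃)) (h2 : M.Adj (g a₂) (h b₁))
    (h3 : M.Adj (g a₃) (h b₄)) (h4 : M.Adj (g a₄) (h b₂)) :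
    ∃ H : SimpleGraph V, IsMP10 M H ∧ s(g 0, h 0) ∈ H.edgeSet := by
  obtain ⟨c, hc⟩ : ∃ c : ℕ → ℕ, c 0 = 0 ∧ c 1 = a₁ ∧ c 2 = a₂ ∧ c 3 = a₃ ∧ c 4 = a₄ ∧ c 5 = m :=
    ⟨fun k => [0, a₁, a₂, a₃, a₄, m].getD k 0, by simp⟩
  obtain ⟨d, hd⟩ : ∃ d : ℕ → ℕ, d 0 = 0 ∧ d 1 = b₁ ∧ d 2 = b₂ ∧ d 3 = b₃ ∧ d 4 = b₄ ∧ d 5 = n :=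
    ⟨fun k => [0, b₁, b₂, b₃, b₄, n].getD k 0, by simp⟩
  obtain ⟨hc0, hc1, hc2, hc3, hc4, hc5⟩ := hc
  obtain ⟨hd0, hd1, hd2, hd3, hd4, hd5⟩ := hd
  have hcm : StrictMonoOn c (Set.Iic 5) := by
    intro i hi j hj hij
    simp only [Set.mem_Iic] at hi hj
    interval_cases j <;> interval_cases i <;> omega
  have hdm : StrictMonoOn d (Set.Iic 5) := by
    intro i hi j hj hij
    simp only [Set.mem_Iic] at hi hj
    interval_cases j <;> interval_cases i <;> omega
  have hM : ∀ i : ZMod 5, M.Adj (g (c i.val)) (h (d (3 * i).val)) := by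
    -- Modulo 5 the multiples `3 * i` for `i = 1, 2, 3, 4` are `3, 1, 4, 2`: the pattern `3142`.
    have hsplit : ∀ i : ZMod 5, (i.val = 0 ∧ (3 * i).val = 0) ∨ (i.val = 1 ∧ (3 * i).val = 3) ∨
        (i.val = 2 ∧ (3 * i).val = 1) ∨ (i.val = 3 ∧ (3 * i).val = 4) ∨
        (i.val = 4 ∧ (3 * i).val = 2) := by decide
    intro i
    rcases hsplit i with ⟨e, e'⟩ | ⟨e, e'⟩ | ⟨e, e'⟩ | ⟨e, e'⟩ | ⟨e, e'⟩ <;>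
      simp only [e, e', hc0, hc1, hc2, hc3, hc4, hd0, hd1, hd2, hd3, hd4] <;> assumption
  let spoke : ZMod 5 → Sym2 V := fun i => s(g (c i.val), h (d (3 * i).val))
  have hinj : Function.Injective spoke := by
    intro i j hij
    have hgij : g (c i.val) = g (c j.val) := by
      rcases Sym2.eq_iff.1 hij with h' | h'
      · exact h'.1
      · exact (P.disjoint _ _ h'.1).elim
    have hlt : ∀ i : ZMod 5, c i.val < m := fun i =>
      hc5 ▸ hcm (by simpa using (ZMod.val_lt i).le) (by simp) (ZMod.val_lt i)
    exact ZMod.val_injective 5 (hcm.injOn (by simpa using (ZMod.val_lt i).le)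
      (by simpa using (ZMod.val_lt j).le) (P.left.inj _ _ (hlt i) (hlt j) hgij))
  have hmem : ∀ i, spoke i ∈ (G.deleteEdges M.edgeSet ⊔
      SimpleGraph.fromEdgeSet (Set.range spoke)).edgeSet := fun i => by
    rw [SimpleGraph.mem_edgeSet, SimpleGraph.sup_adj, SimpleGraph.fromEdgeSet_adj]
    exact .inr ⟨⟨i, rfl⟩, P.disjoint _ _⟩
  refine ⟨G.deleteEdges M.edgeSet ⊔ SimpleGraph.fromEdgeSet (Set.range spoke),
    ⟨⟨Set.range spoke, ?_, ?_, rfl⟩, ?_⟩, ?_⟩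
  · rintro _ ⟨i, rfl⟩
    exact hM i
  · rw [← Set.image_univ, Set.ncard_image_of_injective _ hinj, Set.ncard_univ, Nat.card_zmod]
  · refine P.isSubdivisionOf_petersenGraph hc0 hc5 hcm hd0 hd5 hdm le_sup_left hmem ?_
    intro x y hxy
    rw [SimpleGraph.sup_adj, SimpleGraph.fromEdgeSet_adj] at hxy
    refine hxy.imp_right ?_
    rintro ⟨⟨i, hi⟩, -⟩
    exact ⟨i, hi.symm⟩
  · simpa [spoke, hc0, hd0] using hmem 0

/-- Edges of `M` joining consecutive vertices on both cycles lie in a copy of `C₄`. -/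
theorem exists_isMC4 {G : SimpleGraph V} {M : G.Subgraph} {a b c d : V} (hab : G.Adj a b)
    (hab' : s(a, b) ∉ M.edgeSet) (hcd : G.Adj c d) (hcd' : s(c, d) ∉ M.edgeSet) (hbc : M.Adj b c)
    (hda : M.Adj d a) (hac : a ≠ c) (hbd : b ≠ d) :
    ∃ w : G.Walk a a, IsMC4 M w ∧ w.edges = [s(a, b), s(b, c), s(c, d), s(d, a)] := by
  have hab0 := hab.ne
  have hcd0 := hcd.ne
  have hbc0 := hbc.ne
  have hda0 := hda.ne
  refine ⟨.cons hab (.cons hbc.adj_sub (.cons hcd (.cons hda.adj_sub .nil))), ⟨?_, rfl, ?_⟩, rfl⟩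
  · rw [SimpleGraph.Walk.cons_isCycle_iff]
    constructor
    · simp [SimpleGraph.Walk.cons_isPath_iff]
      tauto
    · simp
      tauto
  · have : {f | f ∈ [s(a, b), s(b, c), s(c, d), s(d, a)] ∧ f ∈ M.edgeSet} =
        {s(b, c), s(d, a)} := by
      ext f
      simp only [List.mem_cons, List.not_mem_nil, or_false, Set.mem_ofPred_eq,
        Set.mem_insert_iff, Set.mem_singleton_iff]
      constructor
      · rintro ⟨rfl | rfl | rfl | rfl, hf⟩ <;> simp_all
      · rintro (rfl | rfl)
        · exact ⟨by simp, hbc⟩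
        · exact ⟨by simp, hda⟩
    change {f | f ∈ [s(a, b), s(b, c), s(c, d), s(d, a)] ∧ f ∈ M.edgeSet}.ncard = 2
    rw [this, Set.ncard_pair]
    simp
    tauto

/-- Since `M` has no edge inside either cycle, it is a bijection `f` between the positions on the
two cycles. The dichotomy between patterns and twins is applied to `f` without position `0`, which
belongs to `e`. -/
theorem IsTwoCycleParam.exists_isMP10_of_forall_isMC4 {G : SimpleGraph V} {M : G.Subgraph}
    {g h : ℕ → V} {m n : ℕ} (P : IsTwoCycleParam (G.deleteEdges M.edgeSet) g m h n) (hm : 3 ≤ m)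
    (hM : M.IsPerfectMatching) (hg : ∀ s t, ¬ M.Adj (g s) (g t)) (hh : ∀ s t, ¬ M.Adj (h s) (h t))
    (h0 : M.Adj (g 0) (h 0))
    (hC4 : ∀ (v : V) (w : G.Walk v v), IsMC4 M w → s(g 0, h 0) ∈ w.edges) :
    ∃ H : SimpleGraph V, IsMP10 M H ∧ s(g 0, h 0) ∈ H.edgeSet := by
  have huniq : ∀ {v x y}, M.Adj v x → M.Adj v y → x = y := fun hx hy =>
    hM.1.eq_of_adj_left hx hy
  have hexist : ∀ v, ∃ w, M.Adj v w := fun v => (hM.1 (hM.2 v)).exists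
  have hpartner : ∀ t, ∃ s < n, M.Adj (g t) (h s) := fun t => by
    obtain ⟨w, hw⟩ := hexist (g t)
    rcases P.cover w with ⟨s, hs, rfl⟩ | ⟨s, hs, rfl⟩
    · exact (hg _ _ hw).elim
    · exact ⟨s, hs, hw⟩
  choose f hfn hf using hpartner
  have hfinj : ∀ s < m, ∀ t < m, f s = f t → s = t := fun s hs t ht hst =>
    P.left.inj s t hs ht (huniq (hf s).symm (hst ▸ (hf t).symm))
  have hfsurj : ∀ s < n, ∃ t < m, f t = s := fun s hs => by
    obtain ⟨w, hw⟩ := hexist (h s)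
    rcases P.cover w with ⟨t, ht, rfl⟩ | ⟨t, ht, rfl⟩
    · exact ⟨t, ht, P.right.inj _ _ (hfn t) hs (huniq (hf t) hw.symm)⟩
    · exact (hh _ _ hw).elim
  have hn : 0 < n := (Nat.zero_le _).trans_lt (hfn 0)
  have hf0 : f 0 = 0 := P.right.inj _ _ (hfn 0) hn (huniq (hf 0) h0)
  have hfpos : ∀ t < m, 0 < t → 0 < f t := fun t ht h0 => Nat.pos_of_ne_zero fun h => by
    have := hfinj t ht 0 (by omega) (by omega)
    omega
  by_cases hav : AvoidsPatterns (fun t => (f t : ℤ)) (Finset.Ico 1 m)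
  · exfalso
    obtain ⟨x, y, hx, hy, hxy, hcons⟩ := hav.exists_twins
      (fun s hs t ht hst => by
        simp only [Finset.coe_Ico, Set.mem_Ico] at hs ht
        exact hfinj s hs.2 t ht.2 (by exact_mod_cast hst)) (by simp; omega)
    simp only [Finset.mem_Ico, Nat.cast_lt] at hx hy hcons
    obtain rfl : y = x + 1 := by
      by_contra hne
      exact (hcons (x + 1) (by omega)).1 (by omega)
    -- Otherwise the value one above the smaller of the two is taken at some `z` and lies strictly
    -- between them; it is positive, so `z ≠ 0`, against the twin property.
    have hvals : f (x + 1) = f x + 1 ∨ f x = f (x + 1) + 1 := by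
      by_contra hne
      have hneq : f x ≠ f (x + 1) := fun h => by
        have := hfinj x hx.2 (x + 1) hy.2 h
        omega
      have h1 := hfn x
      have h2 := hfn (x + 1)
      obtain ⟨z, hz, hfz⟩ := hfsurj (min (f x) (f (x + 1)) + 1) (by omega)
      have hz0 : z ≠ 0 := by
        rintro rfl
        omega
      have := hcons z (by omega)
      omega
    have hcycle : (G.deleteEdges M.edgeSet).Adj (h (f (x + 1))) (h (f x)) := by
      rcases hvals with e | e
      · rw [e]
        exact (P.right.adj _ (hfn x)).symm
      · rw [e]
        exact P.right.adj _ (hfn (x + 1))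
    have hgx := P.left.adj x hx.2
    rw [SimpleGraph.deleteEdges_adj] at hcycle hgx
    obtain ⟨w, hw, hwe⟩ := exists_isMC4 hgx.1 hgx.2 hcycle.1 hcycle.2 (hf (x + 1)) (hf x).symm
      (P.disjoint _ _) (P.disjoint _ _)
    -- The 4-cycle avoids `g 0`, because both of its positions on the first cycle are positive and
    -- less than `m` or else would not lie in the range of the twins.
    have hmem := hC4 _ w hw
    have hd := P.disjoint
    have hd' : ∀ s t, h t ≠ g s := fun s t => (P.disjoint s t).symm
    have hgne : ∀ t < m, 0 < t → g 0 ≠ g t := fun t ht h0 e => by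
      have := P.left.inj 0 t (by omega) ht e
      omega
    have h1 := hgne x hx.2 hx.1
    have h2 := hgne (x + 1) hy.2 (by omega)
    simp [hwe, hd, hd', h1, h2] at hmem
  · simp only [AvoidsPatterns, Finset.mem_Ico, Nat.cast_lt] at hav
    push Not at hav
    obtain ⟨w, hw, x, hx, y, hy, z, hz, hwx, hxy, hyz, hp⟩ := hav
    by_cases hq : f x < f z ∧ f z < f w ∧ f w < f y
    · exact P.exists_isMP10 hw.1 hwx hxy hyz hz.2 (hfpos x hx.2 hx.1) hq.1 hq.2.1 hq.2.2 (hfn y)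
        h0 (hf w) (hf x) (hf y) (hf z)
    · obtain ⟨h1, h2, h3⟩ := hp fun a b => not_lt.1 fun c => hq ⟨a, b, c⟩
      have hrev : ∀ t, M.Adj (g t) (h (n - (n - f t))) := fun t => by
        rw [Nat.sub_sub_self (hfn t).le]
        exact hf t
      have hxn := hfn x
      have hypos := hfpos y hy.2 hy.1
      -- Reversing the second cycle replaces each value `s` by `n - s`, which turns `2413` into
      -- `3142`; the start stays fixed as `h n = h 0`.
      have := P.reverse_right.exists_isMP10 (b₁ := n - f x) (b₂ := n - f z) (b₃ := n - f w)
        (b₄ := n - f y) hw.1 hwx hxy hyz hz.2 (by omega) (by omega) (by omega) (by omega)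
        (by omega) (by simpa [P.right.closes] using h0) (hrev w) (hrev x) (hrev y) (hrev z)
      simpa [P.right.closes] using this

end PermutationGraph

theorem theorem2 {V : Type*} [Fintype V] (G : SimpleGraph V) [DecidableRel G.Adj]
    (M : G.Subgraph) (hGM : PermutationGraph.IsMarked G M) (hV : 6 ≤ Fintype.card V)
    (e : Sym2 V) (he : e ∈ M.edgeSet)
    (hC4 : ∀ (v : V) (w : G.Walk v v), PermutationGraph.IsMC4 M w → e ∈ w.edges) :
    ∃ H : SimpleGraph V, PermutationGraph.IsMP10 M H ∧ e ∈ H.edgeSet := by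
  obtain ⟨-, hM, m, n, hm, hn, φ, hl, hr⟩ := hGM
  -- An `M`-edge inside a cycle would be an edge of that cycle because chords are excluded, but the
  -- cycles avoid `M`.
  have hl' : ∀ i j, ¬ M.Adj (φ (Sum.inl i)) (φ (Sum.inl j)) := fun i j hij => by
    have : (G.deleteEdges M.edgeSet).Adj (φ (Sum.inl i)) (φ (Sum.inl j)) :=
      φ.map_adj_iff.2 (hl i j hij.adj_sub)
    rw [SimpleGraph.deleteEdges_adj] at this
    exact this.2 hij
  have hr' : ∀ i j, ¬ M.Adj (φ (Sum.inr i)) (φ (Sum.inr j)) := fun i j hij => by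
    have : (G.deleteEdges M.edgeSet).Adj (φ (Sum.inr i)) (φ (Sum.inr j)) :=
      φ.map_adj_iff.2 (hr i j hij.adj_sub)
    rw [SimpleGraph.deleteEdges_adj] at this
    exact this.2 hij
  obtain ⟨i, j, rfl⟩ : ∃ i j, e = s(φ (Sum.inl i), φ (Sum.inr j)) := by
    induction e with
    | h x y =>
      obtain ⟨i | i, rfl⟩ := φ.surjective x <;> obtain ⟨j | j, rfl⟩ := φ.surjective y
      · exact (hl' i j he).elim
      · exact ⟨i, j, rfl⟩
      · exact ⟨j, i, Sym2.eq_swap⟩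
      · exact (hr' i j he).elim
  obtain ⟨g, h, rfl, rfl, P⟩ := PermutationGraph.exists_isTwoCycleParam hm hn φ i j
  exact P.exists_isMP10_of_forall_isMC4 hm hM (fun _ _ => hl' _ _) (fun _ _ => hr' _ _) he hC4
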